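/- Let $G$ be an amenable group and let $\mathcal F=(F_i)_{i\in I}$ be a (right) Følner net for $G$, i.e. a family of non-empty finite subsets of $G$ indexed by a directed set $I$ such that $\lim_i |F_i\setminus F_i g|/|F_i| = 0$ for every $g\in G$. Let $X$ be an algebraic variety over an algebraically closed field $K$ (a scheme of finite type over $K$) and let $A := X(K)$ be its set of $K$-points. For a finite set $E$, let $X^E$ be the $K$-fibered product of copies of $X$ indexed by $E$; then $A^E = X^E(K)$ is identified with the set of closed points of $X^E$ and carries the topology induced by the Zariski topology of $X^E$. Let $\tau\colon A^G\to A^G$ be an algebraic cellular automaton over $(G,X,K)$: there are a finite set $M\subset G$ and a $K$-scheme morphism $f\colon X^M\to X$, with induced map $f^{(K)}\colon A^M\to A$ on $K$-points, such that $(\tau(c))(g) = f^{(K)}((g^{-1}c)|_M)$ for all $c\in A^G$ and $g\in G$, where $(g^{-1}c)(h)=c(gh)$. For $\Gamma\subset A^G$ and $\Omega\subset G$ finite, put $\Gamma_\Omega := \{c|_\Omega : c\in\Gamma\}\subset A^\Omega$, and define the algebraic mean dimension of $\Gamma$ by \[ \operatorname{mdim}_{\mathcal F}(\Gamma) := \limsup_{i\in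 I}\frac{\dim(\Gamma_{F_i})}{|F_i|}, \] where $\dim(\Gamma_{F_i})$ is the Krull dimension of $\Gamma_{F_i}\subset A^{F_i}$ for the Zariski topology (with $\dim\varnothing=-\infty$). Proposition. Let $\Gamma\subset A^G$ be a subset such that, for every finite subset $\Omega\subset G$, the set $\Gamma_\Omega$ is a constructible subset of $A^\Omega$ for the Zariski topology (i.e. a finite union of locally closed subsets). Then \[ \operatorname{mdim}_{\mathcal F}(\tau(\Gamma)) \le \operatorname{mdim}_{\mathcal F}(\Gamma). \] -/

import Mathlib

open CategoryTheory CategoryTheory.Limits AlgebraicGeometry Filter Topology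

universe u v w

noncomputable section

namespace AlgCA

/-! ### Cellular automata -/

section Cellular

variable {G : Type v} [Group G] {A : Type u}

/-- The shift action of `G` on configurations: `(g c)(h) = c (g⁻¹ h)`. -/
def shift (g : G) (c : G → A) : G → A := fun h => c (g⁻¹ * h)

/-- The restriction `c|_Ω` of a configuration to a finite subset `Ω` of `G`. -/
def restrict (Ω : Finset G) (c : G → A) : Ω → A := fun g => c g

/-- The set `Γ_Ω = {c|_Ω : c ∈ Γ}` of restrictions to `Ω` of the configurations in `Γ`. -/
def projection (Ω : Finset G) (Γ : Set (G → A)) : Set (Ω → A) := restrict Ω '' Γ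

/-- `τ` is the cellular automaton with memory set `M` and local defining map `μ`:
`τ(c)(g) = μ((g⁻¹ c)|_M)` for all configurations `c` and all `g`. -/
def HasLocalMap (τ : (G → A) → (G → A)) (M : Finset G) (μ : (M → A) → A) : Prop :=
  ∀ (c : G → A) (g : G), τ c g = μ (restrict M (shift g⁻¹ c))

end Cellular

/-! ### Følner nets -/

open Classical in
/-- `F` is a (right) Følner net for `G`: all `F i` are non-empty and, for every `g`,
`|F i \ (F i) g| / |F i|` tends to `0`. -/
structure IsFolnerNet {G : Type v} [Group G] {I : Type w} [Preorder I]
    (F : I → Finset G) : Prop where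
  nonempty : ∀ i, (F i).Nonempty
  tendsto : ∀ g : G,
    Tendsto (fun i => ((F i \ (F i).image (fun h => h * g)).card : ℝ) / ((F i).card : ℝ))
      atTop (𝓝 0)

/-! ### Algebraic varieties, their points and the Zariski topology -/

section Variety

variable {K : Type u} [Field K]

/-- A `K`-scheme is an algebraic variety over `K` if it is of finite type over `K`, that is,
locally of finite type and quasi-compact over `Spec K`. -/
structure IsAlgebraicVariety (X : Over (Spec (CommRingCat.of K))) : Prop where
  locallyOfFiniteType : LocallyOfFiniteType X.hom
  quasiCompact : QuasiCompact X.hom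

/-- The set `X(K)` of `K`-points of `X`: the `K`-scheme morphisms `Spec K ⟶ X`. -/
abbrev Points (X : Over (Spec (CommRingCat.of K))) : Type u :=
  Over.mk (𝟙 (Spec (CommRingCat.of K))) ⟶ X

/-- The `K`-fibered product `X^E` of copies of `X` indexed by the finite set `E`, that is, the
product in the category of `K`-schemes. -/
abbrev power (X : Over (Spec (CommRingCat.of K))) (E : Type v) [Finite E] :
    Over (Spec (CommRingCat.of K)) :=
  ∏ᶜ (fun _ : E => X)

/-- The identification of `X(K)^E` with `X^E(K)` given by the universal property. -/
def toPowerPoint (X : Over (Spec (CommRingCat.of K))) {E : Type v} [Finite E]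
    (a : E → Points X) : Points (power X E) :=
  Pi.lift a

/-- The map `f^{(K)} : X(K)^E → X(K)` induced by a `K`-scheme morphism `f : X^E ⟶ X`. -/
def inducedMap {X : Over (Spec (CommRingCat.of K))} {E : Type v} [Finite E]
    (f : power X E ⟶ X) (a : E → Points X) : Points X :=
  toPowerPoint X a ≫ f

/-- The point of the underlying space of `X` given by a `K`-point, i.e. the image of the unique
point of `Spec K`. -/
def Points.toPoint {X : Over (Spec (CommRingCat.of K))} (x : Points X) : X.left :=
  x.left (IsLocalRing.closedPoint K)

/-- The Zariski topology on `A^E = X(K)^E`: the topology induced from the underlying space of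
the scheme `X^E`, where `A^E = X^E(K)` is viewed as a set of points of `X^E`. -/
abbrev zariski (X : Over (Spec (CommRingCat.of K))) (E : Type v) [Finite E] :
    TopologicalSpace (E → Points X) :=
  TopologicalSpace.induced (fun a => (toPowerPoint X a).toPoint) inferInstance

/-- A subset of `X(K)^E` is (Zariski-)constructible if it is a finite union of subsets that are
locally closed for the Zariski topology. -/
def IsConstructible {X : Over (Spec (CommRingCat.of K))} {E : Type v} [Finite E]
    (C : Set (E → Points X)) : Prop :=
  ∃ 𝒮 : Set (Set (E → Points X)), 𝒮.Finite ∧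
    (∀ S ∈ 𝒮, @IsLocallyClosed _ (zariski X E) S) ∧ C = ⋃₀ 𝒮

/-- The Krull dimension of a subset of `X(K)^E`, with the topology induced by the Zariski
topology; it is `⊥` for the empty set. -/
def dim {X : Over (Spec (CommRingCat.of K))} {E : Type v} [Finite E]
    (C : Set (E → Points X)) : WithBot ℕ∞ :=
  @topologicalKrullDim C (@instTopologicalSpaceSubtype _ (· ∈ C) (zariski X E))

/-- `τ` is an algebraic cellular automaton over `(G, X, K)`: it admits a memory set whose local
defining map is induced by a `K`-scheme morphism `X^M ⟶ X`. -/
def IsAlgebraicCellularAutomaton {G : Type v} [Group G]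
    (X : Over (Spec (CommRingCat.of K)))
    (τ : (G → Points X) → (G → Points X)) : Prop :=
  ∃ (M : Finset G) (f : power X M ⟶ X), HasLocalMap τ M (inducedMap f)

/-- The inclusion of the set of possible dimensions in the extended reals. -/
def dimToEReal : WithBot ℕ∞ → EReal
  | ⊥ => ⊥
  | (n : ℕ∞) => ((n : ENNReal) : EReal)

/-- The algebraic mean dimension `limsup_i dim(Γ_{F i}) / |F i|` of a set `Γ` of configurations
along the net `F`. -/
def mdim {G : Type v} {X : Over (Spec (CommRingCat.of K))}
    {I : Type w} [Preorder I] (F : I → Finset G) (Γ : Set (G → Points X)) : EReal :=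
  limsup (fun i => dimToEReal (dim (projection (F i) Γ)) / ((F i).card : EReal)) atTop

end Variety

end AlgCA

end

/-! For a window `Ω`, the restriction of `τ c` to `Ω` depends only on `c` over `E = Ω ∪ ΩM`, through
a morphism `Φ : X^E ⟶ X^Ω`. Passing from `Ω` to `E` adds at most `∑ m ∈ M, |Ωm \ Ω|` coordinates,
each worth at most a constant `d` in dimension. Hence `dim τ(Γ)_Ω ≤ dim Γ_Ω + d * ∑ m ∈ M, |Ωm \ Ω|`
(`dim_projection_image_le`), and along a Følner net the error divided by `|Ω|` tends to `0`.

Dimensions are compared through transcendence degrees of residue fields at scheme points. These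
cannot increase under a morphism (`trdegAt_map_le`). The residue field of a point of `X^E` is the
compositum of those of its projection to `X^Ω` and of its remaining coordinates, so degrees add up
(`trdegAt_power_le`).

Two comparisons link this to the Krull dimension of a set of `K`-points. The upper bound
`dim_le_of_forall_trdegAt_le` holds for arbitrary sets, so nothing is needed about `τ(Γ)_Ω` or
`Γ_E`. The lower bound `trdegAt_le_dim` is where constructibility of `Γ_Ω` enters: a locally closed
set of `K`-points has enough closed points to see every chain of primes below its generic points. -/

/-! ### Krull dimension and transcendence degree of algebras and fields -/

/-- The Krull dimension is invariant under injective integral extensions. -/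
theorem ringKrullDim_eq_of_isIntegral (R S : Type*) [CommRing R] [CommRing S] [Algebra R S]
    [Algebra.IsIntegral R S] [FaithfulSMul R S] : ringKrullDim R = ringKrullDim S := by
  apply le_antisymm
  · refine iSup_le fun l => ?_
    obtain ⟨⟨Q, hQ, hQl⟩⟩ : Nonempty (Ideal.primesOver l.head.asIdeal S) := inferInstance
    obtain ⟨L, hL, -⟩ := Ideal.exists_ltSeries_of_hasGoingUp (S := S) l Q
    rw [← hL]
    exact Order.LTSeries.length_le_krullDim L
  · refine Order.krullDim_le_of_strictMono (PrimeSpectrum.comap (algebraMap R S)) ?_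
    intro I J h
    exact Ideal.IsIntegral.comap_lt_comap (R := R) (I := I.asIdeal) (J := J.asIdeal) h

/-- The dimension formula for finitely generated domains over a field. -/
theorem exists_trdeg_eq_and_ringKrullDim_eq (K R : Type*) [Field K] [CommRing R] [IsDomain R]
    [Algebra K R] [Algebra.FiniteType K R] :
    ∃ n : ℕ, Algebra.trdeg K R = n ∧ ringKrullDim R = n := by
  obtain ⟨n, g, hg, hint⟩ := exists_integral_inj_algHom_of_fg K R
  algebraize [g.toRingHom]
  have : FaithfulSMul (MvPolynomial (Fin n) K) R := (faithfulSMul_iff_algebraMap_injective _ _).2 hg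
  have : IsScalarTower K (MvPolynomial (Fin n) K) R := .of_algebraMap_eq' g.comp_algebraMap.symm
  refine ⟨n, ?_, ?_⟩
  · have h := lift_trdeg_add_eq K (MvPolynomial (Fin n) K) R
    have h0 : Algebra.trdeg (MvPolynomial (Fin n) K) R = 0 := trdeg_eq_zero_iff.2 inferInstance
    rw [h0, MvPolynomial.trdeg_of_isDomain] at h
    simpa using h.symm
  · rw [← ringKrullDim_eq_of_isIntegral (MvPolynomial (Fin n) K) R,
      MvPolynomial.ringKrullDim_of_isNoetherianRing]
    simp

theorem trdeg_ideal_residueField (K R : Type u) [Field K] [CommRing R] [Algebra K R]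
    (p : Ideal R) [p.IsPrime] :
    Algebra.trdeg K p.ResidueField = Algebra.trdeg K (R ⧸ p) := by
  have := trdeg_add_eq K (R ⧸ p) (A := p.ResidueField)
  have h0 : Algebra.trdeg (R ⧸ p) p.ResidueField = 0 := by
    have : Algebra.IsAlgebraic (R ⧸ p) p.ResidueField :=
      IsLocalization.isAlgebraic _ (nonZeroDivisors (R ⧸ p))
    exact trdeg_eq_zero_iff.2 inferInstance
  rw [← this, h0, add_zero]

open scoped IntermediateField.algebraAdjoinAdjoin in
/-- The transcendence degree of a compositum of finitely many intermediate fields is at most the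
sum of their transcendence degrees. -/
theorem trdeg_le_sum_of_iSup_eq_top {K L : Type u} [Field K] [Field L] [Algebra K L]
    {ι : Type*} [Fintype ι] (F : ι → IntermediateField K L) (hF : ⨆ i, F i = ⊤) (n : ι → ℕ)
    (hn : ∀ i, Algebra.trdeg K (F i) ≤ n i) : Algebra.trdeg K L ≤ (∑ i, n i : ℕ) := by
  classical
  have hfin (i) : FinTrdeg K (F i) :=
    finTrdeg_iff_trdeg.2 ((hn i).trans_lt (Cardinal.natCast_lt_aleph0))
  choose s hs using fun i => exists_finset_isTranscendenceBasis K (F i)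
  let t (i) : Finset L := (s i).map ⟨_, Subtype.val_injective⟩
  let S : Finset L := Finset.univ.biUnion t
  -- `M` is generated by the union of transcendence bases of the `F i`. Each `F i`, hence `L`, is
  -- algebraic over `M`, so the size of the union bounds the degree.
  let M := IntermediateField.adjoin K (S : Set L)
  have hM : ∀ i, F i ≤ (algebraicClosure M L).restrictScalars K := by
    intro i x hx
    have h1 := (hs i).isAlgebraic_field.isAlgebraic ⟨x, hx⟩
    change x ∈ algebraicClosure M L
    rw [mem_algebraicClosure_iff]
    have hle : (IntermediateField.adjoin K (Set.range ((↑) : s i → F i))).map (F i).val ≤ M := by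
      rw [IntermediateField.adjoin_map]
      refine IntermediateField.adjoin.mono _ _ _ ?_
      rintro _ ⟨_, ⟨y, rfl⟩, rfl⟩
      simp only [S, t, Finset.coe_biUnion, Set.mem_iUnion]
      exact ⟨i, by simp, by simp⟩
    obtain ⟨p, hp, hpx⟩ := h1
    let φ : IntermediateField.adjoin K (Set.range ((↑) : s i → F i)) →+* M :=
      ((F i).val.toRingHom.comp (algebraMap _ _)).codRestrict M
        fun y => hle ⟨y.1, y.2, rfl⟩
    refine ⟨p.map φ, (Polynomial.map_ne_zero_iff φ.injective).2 hp, ?_⟩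
    have h3 := congrArg (F i).val hpx
    rw [map_zero] at h3
    rw [← h3, Polynomial.aeval_def, Polynomial.aeval_def, Polynomial.eval₂_map]
    exact (Polynomial.hom_eval₂ p (algebraMap _ _) (F i).val.toRingHom ⟨x, hx⟩).symm
  have htop : (algebraicClosure M L).restrictScalars K = ⊤ := top_le_iff.1 (hF ▸ iSup_le hM)
  have halg : Algebra.IsAlgebraic M L := ⟨fun x => by
    have : x ∈ (algebraicClosure M L).restrictScalars K := htop ▸ trivial
    exact mem_algebraicClosure_iff.1 this⟩
  have halg' : Algebra.IsAlgebraic (Algebra.adjoin K (S : Set L)) L :=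
    (IsFractionRing.comap_isAlgebraic_iff (A := Algebra.adjoin K (S : Set L)) (K := M)).2 halg
  refine (Algebra.IsAlgebraic.trdeg_le_cardinalMk K (S : Set L)).trans ?_
  refine (Cardinal.mk_coe_finset (s := S)).le.trans ?_
  refine Nat.cast_le.2 (Finset.card_biUnion_le.trans (Finset.sum_le_sum fun i _ => ?_))
  rw [Finset.card_map]
  have := (hs i).cardinalMk_eq_trdeg
  rw [Cardinal.mk_coe_finset] at this
  exact_mod_cast this ▸ hn i

/-! ### Transcendence degree at the points of a `K`-scheme -/

noncomputable section

namespace AlgCA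

section TrdegAt

variable {K : Type u} [Field K]

/-- The structure map `K → κ(y)` of the residue field of a point of a `K`-scheme. -/
def residueStructureMap (Y : Over (Spec (CommRingCat.of K))) (y : Y.left) :
    CommRingCat.of K ⟶ Y.left.residueField y :=
  Spec.preimage (Y.left.fromSpecResidueField y ≫ Y.hom)

/-- The residue field of a point of a `K`-scheme as a `K`-algebra. -/
abbrev residueAlgebra (Y : Over (Spec (CommRingCat.of K))) (y : Y.left) :
    Algebra K (Y.left.residueField y) :=
  (residueStructureMap Y y).hom.toAlgebra

/-- The transcendence degree over `K` of the residue field of a point of a `K`-scheme. -/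
def trdegAt (Y : Over (Spec (CommRingCat.of K))) (y : Y.left) : Cardinal.{u} :=
  letI := residueAlgebra Y y
  Algebra.trdeg K (Y.left.residueField y)

lemma residueStructureMap_comp {Y Z : Over (Spec (CommRingCat.of K))} (f : Y ⟶ Z) (y : Y.left) :
    residueStructureMap Z (f.left y) ≫ f.left.residueFieldMap y = residueStructureMap Y y := by
  apply Spec.map_injective
  simp [residueStructureMap]

/-- The extension of residue fields induced by a morphism of `K`-schemes. -/
def residueAlgHom {Y Z : Over (Spec (CommRingCat.of K))} (f : Y ⟶ Z) (y : Y.left) :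
    letI := residueAlgebra Y y
    letI := residueAlgebra Z (f.left y)
    Z.left.residueField (f.left y) →ₐ[K] Y.left.residueField y :=
  letI := residueAlgebra Y y
  letI := residueAlgebra Z (f.left y)
  { (f.left.residueFieldMap y).hom with
    commutes' := fun r => congr($(residueStructureMap_comp f y).hom r) }

lemma trdegAt_map_le {Y Z : Over (Spec (CommRingCat.of K))} (f : Y ⟶ Z) (y : Y.left) :
    trdegAt Z (f.left y) ≤ trdegAt Y y := by
  let := residueAlgebra Y y
  let := residueAlgebra Z (f.left y)
  exact trdeg_le_of_injective (residueAlgHom f y) (residueAlgHom f y).toRingHom.injective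

lemma trdegAt_map_eq {Y Z : Over (Spec (CommRingCat.of K))} (f : Y ⟶ Z) [IsOpenImmersion f.left]
    (y : Y.left) : trdegAt Z (f.left y) = trdegAt Y y := by
  let := residueAlgebra Y y
  let := residueAlgebra Z (f.left y)
  refine (AlgEquiv.ofBijective (residueAlgHom f y) ?_).trdeg_eq
  exact ConcreteCategory.bijective_of_isIso (f.left.residueFieldMap y)

/-- The affine `K`-scheme attached to a commutative `K`-algebra. -/
abbrev specOver (R : CommRingCat.{u}) [Algebra K R] : Over (Spec (CommRingCat.of K)) :=
  Over.mk (Spec.map (CommRingCat.ofHom (algebraMap K R)))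

lemma trdegAt_specOver (R : CommRingCat.{u}) [Algebra K R] (q : PrimeSpectrum R) :
    trdegAt (specOver (K := K) R) q = Algebra.trdeg K (R ⧸ q.asIdeal) := by
  rw [← trdeg_ideal_residueField]
  let : Algebra K ((Spec R).residueField q) := residueAlgebra (specOver (K := K) R) q
  refine (AlgEquiv.ofRingEquiv
    (f := (Scheme.Spec.residueFieldIso R q).commRingCatIsoToRingEquiv) ?_).trdeg_eq
  intro r
  have : residueStructureMap (specOver (K := K) R) q ≫ (Scheme.Spec.residueFieldIso R q).hom =
      CommRingCat.ofHom (algebraMap K q.asIdeal.ResidueField) := by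
    rw [← Iso.eq_comp_inv]
    apply Spec.map_injective
    simp only [residueStructureMap, Spec.map_preimage, Spec.map_comp]
    refine (congrArg (· ≫ Spec.map (CommRingCat.ofHom (algebraMap K R)))
      (Scheme.Spec.map_residueFieldIso_inv_eq_fromSpecResidueField _ q).symm).trans ?_
    rw [Category.assoc, ← Spec.map_comp]
    rfl
  exact congr($(this).hom r)

/-- Affine charts of `K`-schemes locally of finite type, on the level of points. -/
lemma exists_chart (Y : Over (Spec (CommRingCat.of K))) [LocallyOfFiniteType Y.hom] {y : Y.left}
    {U : Set Y.left} (hU : IsOpen U) (hy : y ∈ U) :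
    ∃ (R : Type u) (_ : CommRing R) (_ : Algebra K R) (_ : Algebra.FiniteType K R)
      (e : PrimeSpectrum R → Y.left), IsOpenEmbedding e ∧ y ∈ Set.range e ∧ Set.range e ⊆ U ∧
      ∀ q, trdegAt Y (e q) = Algebra.trdeg K (R ⧸ q.asIdeal) := by
  obtain ⟨R, j, hj, hq, hU⟩ :=
    Scheme.exists_affine_mem_range_and_range_subset (U := ⟨U, hU⟩) hy
  let φ := Spec.preimage (j ≫ Y.hom)
  let : Algebra K R := φ.hom.toAlgebra
  have hφ : Spec.map (CommRingCat.ofHom (algebraMap K R)) = j ≫ Y.hom := Spec.map_preimage _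
  have hft : LocallyOfFiniteType (Spec.map (CommRingCat.ofHom (algebraMap K R))) := by
    rw [hφ]; infer_instance
  refine ⟨R, inferInstance, inferInstance,
    (HasRingHomProperty.Spec_iff (P := @LocallyOfFiniteType)).1 hft, fun q => j q,
    j.isOpenEmbedding, hq, hU, fun q => ?_⟩
  have hj' : IsOpenImmersion (Over.homMk j hφ.symm : specOver (K := K) R ⟶ Y).left := hj
  rw [← trdegAt_specOver R q]
  exact trdegAt_map_eq (Over.homMk j hφ.symm : specOver (K := K) R ⟶ Y) q

end TrdegAt

end AlgCA

end

/-! ### Specialization, chains of closed sets and transcendence degree -/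

/-- A point in the closure of the image of a subset `S` of a Noetherian sober space is a
specialization of the image of the generic point of the closure of an irreducible piece of `S`. -/
theorem exists_specializes_of_mem_closure_image {Z Y : Type*} [TopologicalSpace Z]
    [TopologicalSpace Y] [TopologicalSpace.NoetherianSpace Z] [QuasiSober Z] {Φ : Z → Y}
    (hΦ : Continuous Φ) {S : Set Z} {y : Y} (hy : y ∈ closure (Φ '' S)) :
    ∃ ξ ∈ closure (S ∩ closure {ξ}), Φ ξ ⤳ y := by
  obtain ⟨𝒯, hfin, -, hirr, hS⟩ :=
    TopologicalSpace.NoetherianSpace.exists_finite_set_isClosed_irreducible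
      (isClosed_univ (X := S))
  have hS' : S = ⋃ T ∈ 𝒯, ((↑) : S → Z) '' T := by
    rw [← Set.image_iUnion₂, ← Set.sUnion_eq_biUnion, ← hS]; simp
  rw [hS', Set.image_iUnion₂, hfin.closure_biUnion] at hy
  obtain ⟨T, hT, hy⟩ := Set.mem_iUnion₂.1 hy
  have hirrT : IsIrreducible (((↑) : S → Z) '' T) :=
    (hirr T hT).image _ continuous_subtype_val.continuousOn
  obtain ⟨ξ, hξ⟩ := QuasiSober.sober hirrT.closure isClosed_closure
  have hTξ : ((↑) : S → Z) '' T ⊆ closure {ξ} := hξ.symm ▸ subset_closure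
  refine ⟨ξ, ?_, ?_⟩
  · have h1 : ξ ∈ closure (((↑) : S → Z) '' T) := hξ ▸ subset_closure rfl
    exact closure_mono (Set.subset_inter (Subtype.coe_image_subset S T) hTξ) h1
  · rw [specializes_iff_mem_closure]
    refine closure_minimal ?_ isClosed_closure hy
    rintro _ ⟨x, hx, rfl⟩
    exact specializes_iff_mem_closure.1 ((specializes_iff_mem_closure.2 (hTξ hx)).map hΦ)

noncomputable section

namespace AlgCA

variable {K : Type u} [Field K]

lemma le_iff_specializes_of_isOpenEmbedding {R Y : Type*} [CommRing R] [TopologicalSpace Y]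
    {e : PrimeSpectrum R → Y} (he : IsOpenEmbedding e) (a b : PrimeSpectrum R) :
    a ≤ b ↔ e a ⤳ e b :=
  (PrimeSpectrum.le_iff_specializes a b).trans he.isInducing.specializes_iff.symm

/-- In a chart around `y`, the specialization is an inclusion of primes `p ≤ q`, and `R ⧸ p`
surjects onto `R ⧸ q`. -/
lemma trdegAt_le_of_specializes {Y : Over (Spec (CommRingCat.of K))} [LocallyOfFiniteType Y.hom]
    {z y : Y.left} (h : z ⤳ y) : trdegAt Y y ≤ trdegAt Y z := by
  obtain ⟨R, _, _, _, e, he, ⟨q, rfl⟩, -, htr⟩ := exists_chart Y isOpen_univ (Set.mem_univ y)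
  obtain ⟨p, rfl⟩ := h.mem_open he.isOpen_range ⟨q, rfl⟩
  have hpq : p ≤ q := (le_iff_specializes_of_isOpenEmbedding he p q).2 h
  rw [htr, htr]
  exact trdeg_le_of_surjective (Ideal.Quotient.factorₐ K hpq) (Ideal.Quotient.factor_surjective hpq)

lemma exists_trdegAt_eq (Y : Over (Spec (CommRingCat.of K))) [LocallyOfFiniteType Y.hom]
    (y : Y.left) : ∃ n : ℕ, trdegAt Y y = n := by
  obtain ⟨R, _, _, _, e, he, ⟨q, rfl⟩, -, htr⟩ := exists_chart Y isOpen_univ (Set.mem_univ y)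
  obtain ⟨n, hn, -⟩ := exists_trdeg_eq_and_ringKrullDim_eq K (R ⧸ q.asIdeal)
  exact ⟨n, (htr q).trans hn⟩

/-- A chain of irreducible closed subsets of the closure of `w` has length at most the
transcendence degree at `w`. -/
lemma length_le_trdegAt {Y : Over (Spec (CommRingCat.of K))} [LocallyOfFiniteType Y.hom]
    (l : LTSeries (TopologicalSpace.IrreducibleCloseds Y.left)) {w : Y.left}
    (hw : (l.last : Set Y.left) ⊆ closure {w}) : (l.length : Cardinal) ≤ trdegAt Y w := by
  let gen : TopologicalSpace.IrreducibleCloseds Y.left → Y.left := fun T => T.2.genericPoint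
  have hgen (T : TopologicalSpace.IrreducibleCloseds Y.left) : closure {gen T} = (T : Set Y.left) :=
    T.2.genericPoint_closure_eq.trans T.3.closure_eq
  have hle (S T : TopologicalSpace.IrreducibleCloseds Y.left) : S ≤ T ↔ gen T ⤳ gen S := by
    rw [specializes_iff_closure_subset, hgen, hgen]; rfl
  -- A chart around the generic point of the smallest member contains all its generizations, so this
  -- one chart sees the whole chain and `w`.
  obtain ⟨R, _, _, _, e, he, hq, -, htr⟩ := exists_chart Y isOpen_univ (Set.mem_univ (gen l.head))
  have hspec := le_iff_specializes_of_isOpenEmbedding he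
  have hmem {z : Y.left} (hz : z ⤳ gen l.head) : z ∈ Set.range e :=
    hz.mem_open he.isOpen_range hq
  have hwl : w ⤳ gen l.last := by
    rw [specializes_iff_closure_subset, hgen]; exact hw
  have hl (i) : gen (l i) ⤳ gen l.head := (hle _ _).1 (LTSeries.head_le l i)
  have hwi (i) : w ⤳ gen (l i) := hwl.trans ((hle _ _).1 (l.monotone (Fin.le_last i)))
  obtain ⟨p, rfl⟩ := hmem ((hwi 0).trans (hl 0))
  choose c hc using fun i => hmem (hl i)
  obtain ⟨n, hn, hn'⟩ := exists_trdeg_eq_and_ringKrullDim_eq K (R ⧸ p.asIdeal)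
  rw [htr, hn, Nat.cast_le]
  rw [ringKrullDim_quotient] at hn'
  have hcz (i) : c i ∈ PrimeSpectrum.zeroLocus (p.asIdeal : Set R) := by
    have : p ≤ c i := (hspec _ _).2 (by rw [hc]; exact hwi i)
    exact this
  -- Larger closed sets have smaller primes, so the chain is reversed.
  let l' : LTSeries (PrimeSpectrum.zeroLocus (p.asIdeal : Set R)) := LTSeries.mk l.length
    (fun i => ⟨c i.rev, hcz _⟩) (fun a b hab => by
      have hlt : l b.rev < l a.rev := l.strictMono (Fin.rev_lt_rev.2 hab)
      change c a.rev < c b.rev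
      rw [lt_iff_le_not_ge, hspec, hspec, hc, hc, ← hle, ← hle]
      exact lt_iff_le_not_ge.1 hlt)
  have := Order.LTSeries.length_le_krullDim l'
  rw [hn'] at this
  exact_mod_cast this

/-- If `D` maps inducingly onto a set of points of `Y` which contains all closed points of the
locally closed set `U ∩ Z`, then any `ζ ∈ U` with `closure {ζ} ⊆ Z` has transcendence degree at
most the Krull dimension of `D`. -/
lemma trdegAt_le_topologicalKrullDim {Y : Over (Spec (CommRingCat.of K))}
    [LocallyOfFiniteType Y.hom] {D : Type*} [TopologicalSpace D] {φ : D → Y.left}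
    (hφ : IsInducing φ) {U Z : Set Y.left} (hU : IsOpen U)
    (hD : U ∩ Z ∩ closedPoints Y.left ⊆ Set.range φ) {ζ : Y.left} (hζU : ζ ∈ U)
    (hζZ : closure {ζ} ⊆ Z) {n : ℕ} (hn : trdegAt Y ζ = n) :
    (n : WithBot ℕ∞) ≤ topologicalKrullDim D := by
  have : JacobsonSpace Y.left := LocallyOfFiniteType.jacobsonSpace Y.hom
  obtain ⟨R, _, _, _, e, he, ⟨q, rfl⟩, heU, htr⟩ := exists_chart Y hU hζU
  have hspec := le_iff_specializes_of_isOpenEmbedding he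
  obtain ⟨m, hm, hm'⟩ := exists_trdeg_eq_and_ringKrullDim_eq K (R ⧸ q.asIdeal)
  obtain rfl : n = m := by exact_mod_cast hn.symm.trans ((htr q).trans hm)
  rw [← hm', ringKrullDim_quotient, ← Order.krullDim_orderDual]
  -- Jacobson property: the nonempty locally closed set `U ∩ V ∩ closure {z}` has a closed point,
  -- and that point comes from `D`. This gives both irreducibility and strictness of the traces `T
  -- p` below.
  have key (V : Set Y.left) (hV : IsOpen V) (z : Y.left) (hz : e q ⤳ z) (hzU : z ∈ U)
      (hzV : z ∈ V) : ∃ d, φ d ∈ closure {z} ∧ φ d ∈ V := by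
    have hloc : IsLocallyClosed (U ∩ V ∩ closure {z}) :=
      (hU.inter hV).isLocallyClosed.inter isClosed_closure.isLocallyClosed
    have hne : (U ∩ V ∩ closure {z}).Nonempty := ⟨z, ⟨hzU, hzV⟩, subset_closure rfl⟩
    obtain ⟨y, ⟨⟨hyU, hyV⟩, hyz⟩, hyc⟩ := nonempty_inter_closedPoints hne hloc
    obtain ⟨d, rfl⟩ := hD ⟨⟨hyU, hζZ (specializes_iff_closure_subset.1 hz hyz)⟩, hyc⟩
    exact ⟨d, hyz, hyV⟩
  have hqz (p : PrimeSpectrum.zeroLocus (q.asIdeal : Set R)) : e q ⤳ e p.1 :=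
    (hspec _ _).1 p.2
  have heU' (p : PrimeSpectrum R) : e p ∈ U := heU ⟨p, rfl⟩
  let T (p : (PrimeSpectrum.zeroLocus (q.asIdeal : Set R))ᵒᵈ) :
      TopologicalSpace.IrreducibleCloseds D :=
    { carrier := φ ⁻¹' closure {e (OrderDual.ofDual p).1}
      isClosed' := isClosed_closure.preimage hφ.continuous
      isIrreducible' := by
        refine ⟨?_, ?_⟩
        · obtain ⟨d, hd, -⟩ := key Set.univ isOpen_univ _ (hqz (OrderDual.ofDual p)) (heU' _) trivial
          exact ⟨d, hd⟩
        · rintro u v hu hv ⟨x, hxz, hxu⟩ ⟨y, hyz, hyv⟩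
          obtain ⟨u', hu', rfl⟩ := hφ.isOpen_iff.1 hu
          obtain ⟨v', hv', rfl⟩ := hφ.isOpen_iff.1 hv
          obtain ⟨d, hd, hdu, hdv⟩ := key (u' ∩ v') (hu'.inter hv') _ (hqz (OrderDual.ofDual p))
            (heU' _) ⟨(specializes_iff_mem_closure.2 hxz).mem_open hu' hxu,
              (specializes_iff_mem_closure.2 hyz).mem_open hv' hyv⟩
          exact ⟨d, hd, hdu, hdv⟩ }
  refine Order.krullDim_le_of_strictMono T ?_
  intro a b hab
  have hab' : (OrderDual.ofDual b).1 < (OrderDual.ofDual a).1 := hab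
  rw [lt_iff_le_not_ge, hspec, hspec] at hab'
  have hTab : φ ⁻¹' closure {e (OrderDual.ofDual a).1} ⊆ φ ⁻¹' closure {e (OrderDual.ofDual b).1} :=
    Set.preimage_mono (specializes_iff_closure_subset.1 hab'.1)
  refine lt_of_le_not_ge hTab fun hba => ?_
  obtain ⟨d, hd, hd'⟩ := key (closure {e (OrderDual.ofDual a).1})ᶜ isClosed_closure.isOpen_compl
    _ (hqz (OrderDual.ofDual b)) (heU' _)
    fun h => hab'.2 (specializes_iff_mem_closure.2 h)
  exact hd' (hba hd)

end AlgCA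

end

/-! ### Powers of `X` and their residue fields -/

noncomputable section

namespace AlgCA

variable {K : Type u} [Field K]

section Power

variable (X : Over (Spec (CommRingCat.of K)))

lemma exists_isLimit_fan (P : MorphismProperty Scheme.{u}) [P.IsMultiplicative]
    [P.IsStableUnderBaseChange] (hX : P X.hom) (n : ℕ) :
    ∃ c : Fan (fun _ : Fin n => X), Nonempty (IsLimit c) ∧ P c.pt.hom := by
  induction n with
  | zero =>
    refine ⟨Fan.mk (Over.mk (𝟙 _)) (fun i => i.elim0), ⟨Fan.IsLimit.mk _ (fun s => Over.homMk s.pt.hom)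
      (fun _ i => i.elim0) (fun s m _ => ?_)⟩, P.id_mem _⟩
    exact Over.mkIdTerminal.hom_ext _ _
  | succ n ih =>
    obtain ⟨c, ⟨hc⟩, hP⟩ := ih
    refine ⟨extendFan c (BinaryFan.mk (prod.fst : X ⨯ c.pt ⟶ X) prod.snd),
      ⟨extendFanIsLimit _ hc (prodIsProd X c.pt)⟩, ?_⟩
    have h := Over.isPullback_of_binaryFan_isLimit _ (prodIsProd X c.pt)
    change P (X ⨯ c.pt).hom
    rw [← Over.w (prod.fst : X ⨯ c.pt ⟶ X)]
    exact P.comp_mem _ _ (P.of_isPullback h.flip hP) hX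

lemma power_hom_mem (P : MorphismProperty Scheme.{u}) [P.IsMultiplicative]
    [P.IsStableUnderBaseChange] (hX : P X.hom) (E : Type v) [Finite E] : P (power X E).hom := by
  obtain ⟨n, ⟨e⟩⟩ := Finite.exists_equiv_fin E
  obtain ⟨c, ⟨hc⟩, hP⟩ := exists_isLimit_fan X P hX n
  let i : power X E ≅ c.pt :=
    { hom := Fan.IsLimit.lift hc fun k => Pi.π _ (e.symm k)
      inv := Pi.lift fun k => c.proj (e k)
      hom_inv_id := Pi.hom_ext _ _ fun k => by simp
      inv_hom_id := Fan.IsLimit.hom_ext hc _ _ fun k => by simp }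
  have : IsIso i.hom.left := ((Over.forget _).mapIso i).isIso_hom
  rw [← Over.w i.hom]
  exact P.comp_mem _ _ (P.of_isIso _) hP

instance locallyOfFiniteType_power [LocallyOfFiniteType X.hom] (E : Type v) [Finite E] :
    LocallyOfFiniteType (power X E).hom :=
  power_hom_mem X @LocallyOfFiniteType inferInstance E

instance quasiCompact_power [QuasiCompact X.hom] (E : Type v) [Finite E] :
    QuasiCompact (power X E).hom :=
  power_hom_mem X @QuasiCompact inferInstance E

lemma noetherianSpace_of_locallyOfFiniteType [LocallyOfFiniteType X.hom] [QuasiCompact X.hom] :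
    TopologicalSpace.NoetherianSpace X.left := by
  have : IsLocallyNoetherian X.left := LocallyOfFiniteType.isLocallyNoetherian X.hom
  have : CompactSpace X.left := QuasiCompact.compactSpace_of_compactSpace X.hom
  have : IsNoetherian X.left := {}
  infer_instance

/-- The residue field at a point of a power of `X` is generated by the residue fields at its
coordinates. -/
lemma eq_top_of_forall_fieldRange_le {E : Type v} [Finite E] (ξ : (power X E).left)
    (L : letI := residueAlgebra (power X E) ξ; IntermediateField K ((power X E).left.residueField ξ))
    (hL : ∀ e : E, letI := residueAlgebra (power X E) ξ
      letI := residueAlgebra X ((Pi.π (fun _ : E => X) e).left ξ)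
      (residueAlgHom (Pi.π (fun _ : E => X) e) ξ).fieldRange ≤ L) : L = ⊤ := by
  let := residueAlgebra (power X E) ξ
  let κ : CommRingCat := (power X E).left.residueField ξ
  -- All coordinates of `ξ` are defined over `L`, so by the universal property they assemble into a
  -- morphism `s : Spec L ⟶ X^E` through which the canonical morphism from `Spec κ(ξ)` factors.
  let T : Over (Spec (CommRingCat.of K)) := specOver (CommRingCat.of L)
  let x (e : E) : X.left := (Pi.π (fun _ : E => X) e).left ξ
  let a (e : E) : X.left.residueField (x e) ⟶ CommRingCat.of L :=
    CommRingCat.ofHom ((((Pi.π (fun _ : E => X) e).left.residueFieldMap ξ).hom).codRestrict L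
      fun r => hL e ⟨r, rfl⟩)
  let ι : CommRingCat.of L ⟶ κ := CommRingCat.ofHom L.val.toRingHom
  have ha (e : E) : a e ≫ ι = (Pi.π (fun _ : E => X) e).left.residueFieldMap ξ := by
    ext r; rfl
  have hι : CommRingCat.ofHom (algebraMap K L) ≫ ι = residueStructureMap (power X E) ξ := rfl
  have ha' (e : E) : residueStructureMap X (x e) ≫ a e = CommRingCat.ofHom (algebraMap K L) := by
    ext r
    exact congr($(residueStructureMap_comp (Pi.π (fun _ : E => X) e) ξ).hom r)
  let t (e : E) : T ⟶ X := Over.homMk (Spec.map (a e) ≫ X.left.fromSpecResidueField (x e)) (by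
    have : X.left.fromSpecResidueField (x e) ≫ X.hom = Spec.map (residueStructureMap X (x e)) :=
      (Spec.map_preimage _).symm
    rw [Category.assoc, this, ← Spec.map_comp, ha']
    rfl)
  let s : T ⟶ power X E := Pi.lift t
  let S : Over (Spec (CommRingCat.of K)) := Over.mk (Spec.map (residueStructureMap (power X E) ξ))
  let i : S ⟶ T := Over.homMk (Spec.map ι) (by
    change Spec.map ι ≫ Spec.map _ = _
    rw [← Spec.map_comp, hι]; rfl)
  let p : S ⟶ power X E := Over.homMk ((power X E).left.fromSpecResidueField ξ)
    (Spec.map_preimage _).symm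
  have hp : i ≫ s = p := by
    refine Pi.hom_ext _ _ fun e => ?_
    rw [Category.assoc, Pi.lift_π]
    ext1
    change Spec.map ι ≫ Spec.map (a e) ≫ X.left.fromSpecResidueField (x e) =
      (power X E).left.fromSpecResidueField ξ ≫ (Pi.π (fun _ : E => X) e).left
    rw [← Category.assoc, ← Spec.map_comp, ha, Scheme.Hom.SpecMap_residueFieldMap_fromSpecResidueField]
  have hp' : Spec.map ι ≫ s.left = (power X E).left.fromSpecResidueField ξ := congr($(hp).left)
  let F := Scheme.SpecToEquivOfField L (power X E).left s.left
  have hF : Spec.map F.2 ≫ (power X E).left.fromSpecResidueField F.1 = s.left :=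
    (Scheme.SpecToEquivOfField L (power X E).left).symm_apply_apply s.left
  -- A morphism from the spectrum of a field is a point with a map out of its residue field.
  -- Comparing these data shows that the identity of `κ(ξ)` factors through `L`.
  have hpair : (⟨F.1, F.2 ≫ ι⟩ : Σ y : (power X E).left, (power X E).left.residueField y ⟶ .of κ) =
      ⟨ξ, 𝟙 _⟩ := by
    apply (Scheme.SpecToEquivOfField κ (power X E).left).symm.injective
    change Spec.map (F.2 ≫ ι) ≫ (power X E).left.fromSpecResidueField F.1 =
      Spec.map (𝟙 κ) ≫ (power X E).left.fromSpecResidueField ξ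
    rw [Spec.map_comp, Category.assoc, hF, hp', Spec.map_id, Category.id_comp]
  obtain ⟨h, hFι⟩ := Scheme.SpecToEquivOfField_eq_iff.1 hpair
  rw [eq_top_iff]
  intro r _
  have hr := congr($(hFι).hom (((power X E).left.residueFieldCongr h).inv r))
  have hr' : ι (F.2 (((power X E).left.residueFieldCongr h).inv r)) = r := by
    exact hr.trans congr($(((power X E).left.residueFieldCongr h).inv_hom_id).hom r)
  rw [← hr']
  exact (F.2 (((power X E).left.residueFieldCongr h).inv r) : L).2

end Power

end AlgCA

end

/-! ### Dimension of sets of `K`-points -/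

noncomputable section

namespace AlgCA

variable {K : Type u} [Field K]

/-- Finitely many affine charts suffice, and on each the number of algebra generators is a bound. -/
lemma exists_forall_trdegAt_le (X : Over (Spec (CommRingCat.of K))) [LocallyOfFiniteType X.hom]
    [QuasiCompact X.hom] : ∃ d : ℕ, ∀ x : X.left, trdegAt X x ≤ d := by
  have : CompactSpace X.left := QuasiCompact.compactSpace_of_compactSpace X.hom
  suffices h : ∃ d : ℕ, ∀ x ∈ (Set.univ : Set X.left), trdegAt X x ≤ d by simpa using h
  refine isCompact_univ.induction_on (p := fun s : Set X.left => ∃ d : ℕ, ∀ x ∈ s, trdegAt X x ≤ d)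
    ⟨0, by simp⟩ (fun s t hst ⟨d, hd⟩ => ⟨d, fun x hx => hd x (hst hx)⟩)
    (fun s t ⟨d, hd⟩ ⟨d', hd'⟩ => ⟨max d d', ?_⟩) (fun x _ => ?_)
  · rintro x (hx | hx)
    · exact (hd x hx).trans (Nat.cast_le.2 (le_max_left _ _))
    · exact (hd' x hx).trans (Nat.cast_le.2 (le_max_right _ _))
  · obtain ⟨R, _, _, hfin, e, he, hx, -, htr⟩ := exists_chart X isOpen_univ (Set.mem_univ x)
    obtain ⟨n, g, hg⟩ := Algebra.FiniteType.iff_quotient_mvPolynomial''.1 hfin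
    refine ⟨Set.range e, mem_nhdsWithin_of_mem_nhds (he.isOpen_range.mem_nhds hx), n, ?_⟩
    rintro _ ⟨q, rfl⟩
    have := lift_trdeg_le_of_surjective ((Ideal.Quotient.mkₐ K q.asIdeal).comp g)
      ((Ideal.Quotient.mkₐ_surjective K q.asIdeal).comp hg)
    rw [htr]
    simpa using this

lemma residueAlgHom_comp_fieldRange_le {Y Z W : Over (Spec (CommRingCat.of K))} (f : Y ⟶ Z)
    (g : Z ⟶ W) {h : Y ⟶ W} (hfg : f ≫ g = h) (y : Y.left) :
    letI := residueAlgebra Y y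
    letI := residueAlgebra Z (f.left y)
    letI := residueAlgebra W (h.left y)
    (residueAlgHom h y).fieldRange ≤ (residueAlgHom f y).fieldRange := by
  subst hfg
  rintro _ ⟨r, rfl⟩
  exact ⟨g.left.residueFieldMap (f.left y) r,
    congr($(Scheme.residueFieldMap_comp f.left g.left y).hom r).symm⟩

/-- The morphism `X^E ⟶ X^{E'}` induced by a map `E' → E`. -/
def powerMap (X : Over (Spec (CommRingCat.of K))) {E E' : Type v} [Finite E] [Finite E']
    (i : E' → E) : power X E ⟶ power X E' :=
  Pi.lift fun k => Pi.π _ (i k)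

/-- The coordinates reached by `i` are accounted for by the projection to `X^E'`; each of the
others, all in `s`, costs at most `d`. -/
lemma trdegAt_power_le (X : Over (Spec (CommRingCat.of K))) {E E' : Type v} [Finite E] [Finite E']
    (i : E' → E) (s : Finset E) (hs : ∀ e, e ∈ Set.range i ∨ e ∈ s) {d : ℕ}
    (hd : ∀ x : X.left, trdegAt X x ≤ d) (ξ : (power X E).left) {m : ℕ}
    (hm : trdegAt (power X E') ((powerMap X i).left ξ) ≤ m) :
    trdegAt (power X E) ξ ≤ (m + s.card * d : ℕ) := by
  let := residueAlgebra (power X E) ξ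
  let := residueAlgebra (power X E') ((powerMap X i).left ξ)
  let (e : E) := residueAlgebra X ((Pi.π (fun _ : E => X) e).left ξ)
  let L : Option s → IntermediateField K ((power X E).left.residueField ξ)
    | none => (residueAlgHom (powerMap X i) ξ).fieldRange
    | some e => (residueAlgHom (Pi.π (fun _ : E => X) e.1) ξ).fieldRange
  have htop : ⨆ k, L k = ⊤ := by
    refine eq_top_of_forall_fieldRange_le X ξ _ fun e => ?_
    rcases hs e with ⟨k, rfl⟩ | he
    · exact (residueAlgHom_comp_fieldRange_le (powerMap X i) (Pi.π _ k)
        (Pi.lift_π _ _) ξ).trans (le_iSup L none)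
    · exact le_iSup L (some ⟨e, he⟩)
  have := trdeg_le_sum_of_iSup_eq_top L htop (fun k => k.elim m fun _ => d) (by
    rintro (_ | e)
    · exact (trdeg_le_of_surjective _
        (residueAlgHom (powerMap X i) ξ).rangeRestrict_surjective).trans hm
    · exact (trdeg_le_of_surjective _
        (residueAlgHom (Pi.π (fun _ : E => X) e.1) ξ).rangeRestrict_surjective).trans (hd _))
  refine this.trans (Nat.cast_le.2 (le_of_eq ?_))
  simp [Fintype.sum_option]

/-- The point of `X^E` given by a family of `K`-points of `X`. -/
def powerPoint (X : Over (Spec (CommRingCat.of K))) {E : Type v} [Finite E] (a : E → Points X) :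
    (power X E).left :=
  (toPowerPoint X a).toPoint

lemma isInducing_powerPoint (X : Over (Spec (CommRingCat.of K))) (E : Type v) [Finite E] :
    @IsInducing _ _ (zariski X E) _ (powerPoint X (E := E)) :=
  @IsInducing.mk _ _ (zariski X E) _ _ rfl

/-- This is the Nullstellensatz: over an algebraically closed field the closed points are rational.
-/
lemma exists_powerPoint_eq [IsAlgClosed K] (X : Over (Spec (CommRingCat.of K)))
    [LocallyOfFiniteType X.hom] {E : Type v} [Finite E] {y : (power X E).left}
    (hy : y ∈ closedPoints (power X E).left) : ∃ a, powerPoint X a = y := by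
  let p : Points (power X E) := Over.homMk (pointOfClosedPoint (power X E).hom y hy)
    (pointOfClosedPoint_comp _ _ _)
  refine ⟨fun e => p ≫ Pi.π _ e, ?_⟩
  have hp : toPowerPoint X (fun e => p ≫ Pi.π _ e) = p :=
    Pi.hom_ext _ _ fun e => by simp [toPowerPoint]
  rw [powerPoint, hp]
  exact pointOfClosedPoint_apply (power X E).hom y hy _

/-- The transcendence degree at a point of the Zariski closure of a constructible set `C` of
`K`-points is at most the Krull dimension of `C`. -/
lemma trdegAt_le_dim [IsAlgClosed K] (X : Over (Spec (CommRingCat.of K)))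
    [LocallyOfFiniteType X.hom] [QuasiCompact X.hom] {E : Type v} [Finite E]
    {C : Set (E → Points X)} (hC : IsConstructible C) {y : (power X E).left}
    (hy : y ∈ closure (powerPoint X '' C)) {m : ℕ} (hm : trdegAt (power X E) y = m) :
    (m : WithBot ℕ∞) ≤ dim C := by
  let := zariski X E
  have := noetherianSpace_of_locallyOfFiniteType (power X E)
  have hind := isInducing_powerPoint X E
  obtain ⟨𝒮, hfin, hloc, rfl⟩ := hC
  rw [Set.sUnion_eq_biUnion, Set.image_iUnion₂, hfin.closure_biUnion] at hy
  obtain ⟨S, hS, hy⟩ := Set.mem_iUnion₂.1 hy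
  obtain ⟨U', Z', hU', hZ', hSUZ⟩ := hloc S hS
  obtain ⟨U, hU, rfl⟩ := hind.isOpen_iff.1 hU'
  obtain ⟨Z, hZ, rfl⟩ := hind.isClosed_iff.1 hZ'
  rw [← Set.image_id (powerPoint X '' S)] at hy
  obtain ⟨ζ, hζ, hζy⟩ := exists_specializes_of_mem_closure_image continuous_id hy
  obtain ⟨n, hn⟩ := exists_trdegAt_eq (power X E) ζ
  have hmn : m ≤ n := by
    have := trdegAt_le_of_specializes hζy
    rw [id, hm, hn] at this
    exact_mod_cast this
  refine (Nat.cast_le.2 hmn).trans ?_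
  -- `ζ` is a generization of a point of `S`, and open sets are stable under generization.
  have hζU : ζ ∈ U := by
    obtain ⟨_, ⟨s, hs, rfl⟩, hsζ⟩ := closure_nonempty_iff.1 ⟨ζ, hζ⟩
    exact (specializes_iff_mem_closure.2 hsζ).mem_open hU (hSUZ ▸ hs).1
  have hζZ : closure {ζ} ⊆ Z := by
    refine closure_minimal (Set.singleton_subset_iff.2 ?_) hZ
    refine closure_minimal ?_ hZ hζ
    rintro _ ⟨⟨s, hs, rfl⟩, -⟩
    exact (hSUZ ▸ hs).2
  refine trdegAt_le_topologicalKrullDim (hind.comp IsInducing.subtypeVal) hU ?_ hζU hζZ hn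
  rintro z ⟨⟨hzU, hzZ⟩, hz⟩
  obtain ⟨a, rfl⟩ := exists_powerPoint_eq X hz
  exact ⟨⟨a, S, hS, hSUZ ▸ ⟨hzU, hzZ⟩⟩, rfl⟩

/-- The Krull dimension of a set `D` of `K`-points contained in the image of a set `P` under a
morphism `Φ` is bounded by the transcendence degrees at the images of the points of the closure
of `P`. -/
lemma dim_le_of_forall_trdegAt_le (X : Over (Spec (CommRingCat.of K)))
    [LocallyOfFiniteType X.hom] {E : Type v} [Finite E]
    {Y : Over (Spec (CommRingCat.of K))} [TopologicalSpace.NoetherianSpace Y.left]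
    (Φ : Y ⟶ power X E) {P : Set Y.left} {D : Set (E → Points X)}
    (hD : powerPoint X '' D ⊆ Φ.left '' P) (N : ℕ)
    (hN : ∀ ξ ∈ closure P, trdegAt (power X E) (Φ.left ξ) ≤ N) : dim D ≤ N := by
  let := zariski X E
  have hind : IsInducing (fun a : D => powerPoint X a.1) :=
    (isInducing_powerPoint X E).comp IsInducing.subtypeVal
  refine iSup_le fun l => ?_
  -- Taking closures in `X^E` keeps the chain strict. The generic point `w` of its largest member is
  -- then a specialization of some `Φ ξ` with `ξ` in the closure of `P`.
  let l' := l.map _ (TopologicalSpace.IrreducibleCloseds.map_strictMono_of_isInducing hind)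
  let w := l'.last.2.genericPoint
  have hw : closure {w} = (l'.last : Set (power X E).left) :=
    l'.last.2.genericPoint_closure_eq.trans l'.last.3.closure_eq
  have hlast : (l'.last : Set (power X E).left) ⊆ closure (Φ.left '' P) := by
    refine closure_mono (Set.Subset.trans ?_ hD)
    rintro _ ⟨a, -, rfl⟩
    exact ⟨a.1, a.2, rfl⟩
  obtain ⟨ξ, hξ, hξw⟩ := exists_specializes_of_mem_closure_image Φ.left.continuous
    (hlast (hw ▸ subset_closure rfl : w ∈ (l'.last : Set (power X E).left)))
  have h1 := length_le_trdegAt l' (w := Φ.left ξ) (hw ▸ specializes_iff_closure_subset.1 hξw)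
  have h2 : (l.length : Cardinal) ≤ N :=
    h1.trans (hN ξ (closure_mono Set.inter_subset_left hξ))
  exact_mod_cast h2

end AlgCA

end

/-! ### The estimate over a finite window -/

noncomputable section

namespace AlgCA

variable {K : Type u} [Field K]

lemma toPoint_comp {X Y : Over (Spec (CommRingCat.of K))} (g : Y ⟶ X) (p : Points Y) :
    Points.toPoint (p ≫ g) = g.left p.toPoint := by
  simp only [Points.toPoint, Over.comp_left]
  exact Scheme.Hom.comp_apply _ _ _

lemma dim_empty {X : Over (Spec (CommRingCat.of K))} {E : Type v} [Finite E] :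
    dim (∅ : Set (E → Points X)) = ⊥ := by
  let := zariski X E
  exact Order.krullDim_eq_bot_iff.2 ⟨fun T => isEmptyElim T.2.nonempty.some⟩

open Classical in
/-- The dimension of the image of `Γ` under an algebraic cellular automaton, over a window `Ω`. -/
lemma dim_projection_image_le [IsAlgClosed K] {G : Type v} [Group G]
    (X : Over (Spec (CommRingCat.of K))) [LocallyOfFiniteType X.hom] [QuasiCompact X.hom]
    {τ : (G → Points X) → (G → Points X)} {M : Finset G} {f : power X M ⟶ X}
    (hτ : HasLocalMap τ M (inducedMap f)) {Γ : Set (G → Points X)} (Ω : Finset G)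
    (hΓ : IsConstructible (projection Ω Γ)) {d : ℕ} (hd : ∀ x : X.left, trdegAt X x ≤ d) :
    dim (projection Ω (τ '' Γ)) ≤
      dim (projection Ω Γ) + ((∑ m ∈ M, (Ω.image (· * m) \ Ω).card) * d : ℕ) := by
  let E : Finset G := Ω ∪ M.biUnion fun m => Ω.image (· * m)
  have hE (g : Ω) (m : M) : (g : G) * m ∈ E :=
    Finset.mem_union_right _ (Finset.mem_biUnion.2 ⟨m, m.2, Finset.mem_image_of_mem _ g.2⟩)
  let i : Ω → E := fun g => ⟨g, Finset.mem_union_left _ g.2⟩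
  let s : Finset E := Finset.univ.filter fun e => (e : G) ∉ Ω
  have hs (e : E) : e ∈ Set.range i ∨ e ∈ s := by
    by_cases he : (e : G) ∈ Ω
    · exact .inl ⟨⟨e, he⟩, rfl⟩
    · exact .inr (by simp [s, he])
  have hcard : s.card ≤ ∑ m ∈ M, (Ω.image (· * m) \ Ω).card := by
    refine le_trans ?_ (Finset.card_biUnion_le)
    rw [← Finset.card_map (Function.Embedding.subtype _)]
    refine Finset.card_le_card ?_
    intro g hg
    simp only [s, E, Finset.mem_map, Finset.mem_filter, Finset.mem_univ, true_and,
      Function.Embedding.subtype_apply, Subtype.exists, Finset.mem_union, Finset.mem_biUnion] at hg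
    obtain ⟨g, hgE, hgΩ, rfl⟩ := hg
    obtain ⟨m, hm, hgm⟩ := hgE.resolve_left hgΩ
    exact Finset.mem_biUnion.2 ⟨m, hm, Finset.mem_sdiff.2 ⟨hgm, hgΩ⟩⟩
  let Φ : power X E ⟶ power X Ω :=
    Pi.lift fun g => powerMap X (fun m : M => (⟨g * m, hE g m⟩ : E)) ≫ f
  have hΦ (c : G → Points X) :
      powerPoint X (restrict Ω (τ c)) = Φ.left (powerPoint X (restrict E c)) := by
    rw [powerPoint, powerPoint, ← toPoint_comp]
    congr 1
    refine Pi.hom_ext _ _ fun g => ?_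
    rw [toPowerPoint, Pi.lift_π, Category.assoc, Pi.lift_π, restrict, hτ, inducedMap,
      ← Category.assoc]
    congr 1
    refine Pi.hom_ext _ _ fun m => ?_
    simp [toPowerPoint, powerMap, restrict, shift]
  have hi (c : G → Points X) :
      powerPoint X (restrict Ω c) = (powerMap X i).left (powerPoint X (restrict E c)) := by
    rw [powerPoint, powerPoint, ← toPoint_comp]
    congr 1
    refine Pi.hom_ext _ _ fun g => ?_
    simp [toPowerPoint, powerMap, restrict, i]
  have := noetherianSpace_of_locallyOfFiniteType (power X E)
  let P : Set (power X E).left := (fun c => powerPoint X (restrict E c)) '' Γ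
  have hD : powerPoint X '' projection Ω (τ '' Γ) ⊆ Φ.left '' P := by
    rintro _ ⟨_, ⟨_, ⟨c, hc, rfl⟩, rfl⟩, rfl⟩
    exact ⟨_, ⟨c, hc, rfl⟩, (hΦ c).symm⟩
  have hP {ξ} (hξ : ξ ∈ closure P) :
      (powerMap X i).left ξ ∈ closure (powerPoint X '' projection Ω Γ) := by
    refine closure_mono ?_ (image_closure_subset_closure_image (powerMap X i).left.continuous
      ⟨ξ, hξ, rfl⟩)
    rintro _ ⟨_, ⟨c, hc, rfl⟩, rfl⟩
    exact ⟨_, ⟨c, hc, rfl⟩, hi c⟩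
  set N := (∑ m ∈ M, (Ω.image (· * m) \ Ω).card) * d
  -- Here `m` is the degree at the projection of `ξ` to `X^Ω`, which lies in the closure of `Γ_Ω`.
  have key {ξ} (hξ : ξ ∈ closure P) : ∃ m : ℕ, (m : WithBot ℕ∞) ≤ dim (projection Ω Γ) ∧
      trdegAt (power X Ω) (Φ.left ξ) ≤ (m + N : ℕ) := by
    obtain ⟨m, hm⟩ := exists_trdegAt_eq (power X Ω) ((powerMap X i).left ξ)
    refine ⟨m, trdegAt_le_dim X hΓ (hP hξ) hm, (trdegAt_map_le Φ ξ).trans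
      ((trdegAt_power_le X i s hs hd ξ hm.le).trans (Nat.cast_le.2 ?_))⟩
    exact Nat.add_le_add_left (Nat.mul_le_mul_right _ hcard) _
  rcases Γ.eq_empty_or_nonempty with rfl | ⟨c, hc⟩
  · simp [projection, dim_empty]
  -- With `Γ` nonempty, `key` excludes `⊥`; for `⊤` there is nothing to prove.
  cases hdim : dim (projection Ω Γ) with
  | bot =>
    obtain ⟨m, hm, -⟩ := key (subset_closure ⟨c, hc, rfl⟩)
    rw [hdim] at hm
    exact absurd hm (by simp)
  | coe k =>
    cases k with
    | top => exact le_top.trans (top_add (N : ℕ∞) ▸ le_rfl : _ ≤ ((⊤ + (N : ℕ∞) : ℕ∞) : WithBot ℕ∞))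
    | coe k =>
      refine (dim_le_of_forall_trdegAt_le X Φ hD (k + N) fun ξ hξ => ?_).trans (by simp)
      obtain ⟨m, hm, hmN⟩ := key hξ
      rw [hdim] at hm
      exact hmN.trans (Nat.cast_le.2 (Nat.add_le_add_right (by exact_mod_cast hm) _))

end AlgCA

end

/-! ### Passage to the limit along the Følner net -/

namespace AlgCA

lemma dimToEReal_mono : Monotone dimToEReal := by
  intro a b h
  cases a with
  | bot => exact bot_le
  | coe a =>
    cases b with
    | bot => exact absurd h (by simp)
    | coe b =>
      have : a ≤ b := by exact_mod_cast h
      simpa [dimToEReal] using this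

lemma dimToEReal_add_natCast (a : WithBot ℕ∞) (n : ℕ) :
    dimToEReal (a + n) = dimToEReal a + ((n : ℝ) : EReal) := by
  cases a with
  | bot => simp [dimToEReal]
  | coe a =>
    change (((a + (n : ℕ∞) : ℕ∞) : ENNReal) : EReal) = _
    simp only [dimToEReal, ENat.toENNReal_add, ENat.toENNReal_coe, EReal.coe_ennreal_add]
    rw [← ENNReal.coe_natCast n, EReal.coe_nnreal_eq_coe_real, NNReal.coe_natCast]

open Classical in
lemma IsFolnerNet.tendsto_sum {G : Type v} [Group G] {I : Type w} [Preorder I] {F : I → Finset G}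
    (hF : IsFolnerNet F) (M : Finset G) (d : ℕ) :
    Tendsto (fun i => (((∑ m ∈ M, ((F i).image (· * m) \ F i).card) * d : ℕ) : ℝ) / (F i).card)
      atTop (𝓝 0) := by
  have h := (tendsto_finsetSum M fun m _ => hF.tendsto m).mul_const (d : ℝ)
  simp only [Finset.sum_const_zero, zero_mul] at h
  refine h.congr fun i => ?_
  rw [← Finset.sum_div, div_mul_eq_mul_div]
  congr 1
  push_cast
  congr 1
  refine Finset.sum_congr rfl fun m _ => ?_
  -- Translation preserves cardinality, so `|Fm \ F| = |F \ Fm|`.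
  rw [Finset.card_sdiff_comm]
  exact (Finset.card_image_of_injective _ (mul_left_injective m)).symm

end AlgCA

theorem mainTheorem9 {G : Type v} [Group G]
    {I : Type w} [Preorder I] [IsDirectedOrder I] [Nonempty I]
    (F : I → Finset G) (hF : AlgCA.IsFolnerNet F)
    {K : Type u} [Field K] [IsAlgClosed K]
    (X : Over (Spec (CommRingCat.of K))) (hX : AlgCA.IsAlgebraicVariety X)
    (τ : (G → AlgCA.Points X) → (G → AlgCA.Points X))
    (hτ : AlgCA.IsAlgebraicCellularAutomaton X τ)
    (Γ : Set (G → AlgCA.Points X))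
    (hΓ : ∀ Ω : Finset G, AlgCA.IsConstructible (AlgCA.projection Ω Γ)) :
    AlgCA.mdim F (τ '' Γ) ≤ AlgCA.mdim F Γ := by
  classical
  have := hX.locallyOfFiniteType
  have := hX.quasiCompact
  obtain ⟨M, f, hf⟩ := hτ
  obtain ⟨d, hd⟩ := AlgCA.exists_forall_trdegAt_le X
  let u : I → EReal := fun i =>
    AlgCA.dimToEReal (AlgCA.dim (AlgCA.projection (F i) Γ)) / ((F i).card : EReal)
  let N : I → ℕ := fun i => (∑ m ∈ M, ((F i).image (· * m) \ F i).card) * d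
  let v : I → EReal := fun i => (((N i : ℝ) / (F i).card : ℝ) : EReal)
  have hv : limsup v atTop = 0 :=
    ((continuous_coe_real_ereal.tendsto 0).comp (hF.tendsto_sum M d)).limsup_eq
  have hle : ∀ i, AlgCA.dimToEReal (AlgCA.dim (AlgCA.projection (F i) (τ '' Γ))) /
      ((F i).card : EReal) ≤ (u + v) i := by
    intro i
    have h := AlgCA.dimToEReal_mono (AlgCA.dim_projection_image_le X hf (F i) (hΓ (F i)) hd)
    rw [AlgCA.dimToEReal_add_natCast] at h
    refine (EReal.div_le_div_right_of_nonneg (by positivity) h).trans (le_of_eq ?_)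
    simp only [Pi.add_apply, u, v, EReal.coe_div]
    rw [EReal.add_div_of_nonneg_right (by positivity)]
    simp only [EReal.coe_natCast, N]
  calc AlgCA.mdim F (τ '' Γ) ≤ limsup (u + v) atTop := limsup_le_limsup (.of_forall hle)
    _ ≤ limsup u atTop + limsup v atTop :=
      -- Subadditivity in `EReal` must avoid `⊤ + ⊥`; it suffices that `limsup v = 0` is finite.
      EReal.limsup_add_le (.inr (by simp [hv])) (.inr (by simp [hv]))
    _ = AlgCA.mdim F Γ := by rw [hv, add_zero]; rfl
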